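/- Let $G=(V,E)$ be a finite undirected (simple) graph with $n=|V|$ nodes, let $f$ be an integer with $0<f<n$, and let $L,U,\epsilon$ be real numbers with $U-L>\epsilon>0$. Consider the asynchronous local broadcast model on $G$: every node $u$ runs a deterministic state machine that may depend on $u$, $G$, $f$, $L$, $U$ and $\epsilon$; there is no clock; the nodes proceed at arbitrary varying speeds (every non-faulty node keeps taking steps); each message sent by a node is received, identically and correctly, by all its neighbors, each of which knows the sender, after an unbounded but finite delay, and every link is FIFO; at most $f$ nodes are Byzantine faulty and behave arbitrarily, except that their messages, too, are received identically by all their neighbors. An algorithm solves $\epsilon$-approximate Byzantine consensus on $G$ tolerating at most $f$ Byzantine faulty nodes if, for all real inputs of the nodes in $[L,U]$, every set of at most $f$ faulty nodes and every execution: (agreement) the outputs of any two non-faulty nodes differ by at most $\epsilon$; (validity) the output of each non-faulty node lies in the convex hull of the inputs of the non-faulty nodes; (termination) every non-faulty node decides on an output in finite time. If there exists an algorithm that solves $\epsilon$-approximate Byzantine consensus on $G$ under this model tolerating at most $f$ Byzantine faulty nodes, then $G$ is $(2f+1)$-connected, that is, $n>2f+1$ and $G$ remains connected whenever at most $2f$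 of its vertices are removed. -/

import Mathlib

universe u v w

namespace AsyncBroadcast

/-- A deterministic distributed algorithm for the nodes `V`: one state machine per node. The family
of machines is arbitrary, so each node may know the graph, its own name, the bounds on the inputs,
the tolerance and the number of faults. There is no clock: a transition depends on the local state
and on the received message only. -/
structure Algorithm (V : Type u) where
  /-- The messages. -/
  Msg : Type v
  /-- The local states of each node. -/
  State : V → Type w
  /-- The state in which a node starts, given its input. -/
  start : (a : V) → ℝ → State a
  /-- One step of node `a`: it receives at most one message, whose sender it knows, changes its
  state and broadcasts a finite list of messages, in this order, to its neighbors. -/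
  step : (a : V) → State a → Option (V × Msg) → State a × List Msg
  /-- The output of a node, `none` as long as it is undecided. -/
  output : (a : V) → State a → Option ℝ
  /-- A decision is final. (A node that takes no further steps after its decision is one whose
  later transitions keep the state and broadcast nothing.) -/
  output_stable : ∀ (a : V) (s : State a) (r : Option (V × Msg)) (y : ℝ),
    output a s = some y → output a (step a s r).1 = some y

/-- What can happen at one moment of an execution. -/
inductive Event (V : Type u) (M : Type v) where
  /-- Nothing happens. -/
  | idle : Event V M
  /-- The non-faulty node `a` takes a step without receiving a message. -/
  | tick (a : V) : Event V M
  /-- The non-faulty node `b` receives the next message on the link from `a` and takes a step. -/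
  | deliver (a b : V) : Event V M
  /-- The faulty node `a` broadcasts an arbitrary list of messages. -/
  | byzantine (a : V) (ms : List M) : Event V M

/-- A global configuration. Under local broadcast a message goes identically to all neighbors, so
there is one list of sent messages per node, and on the FIFO link from `a` to `b` only the number
of messages received so far has to be recorded. The entry `state a` of a faulty node `a` plays no
role. -/
structure Config {V : Type u} (A : Algorithm.{u, v, w} V) where
  /-- The local states. -/
  state : (a : V) → A.State a
  /-- `sent a` lists all messages broadcast by `a` so far, in order. -/
  sent : V → List A.Msg
  /-- `received a b` is the number of messages of `a` that `b` has received so far. -/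
  received : V → V → ℕ

namespace Algorithm

variable {V : Type u} [DecidableEq V] (A : Algorithm.{u, v, w} V)

/-- The configuration in which every node is in its start state and nothing has been sent. -/
def startConfig (input : V → ℝ) : Config A where
  state a := A.start a (input a)
  sent _ := []
  received _ _ := 0

/-- Node `a` executes one step of its state machine, with the received message `r` if any. -/
def exec (c : Config A) (a : V) (r : Option (V × A.Msg)) : Config A where
  state := Function.update c.state a (A.step a (c.state a) r).1
  sent := Function.update c.sent a (c.sent a ++ (A.step a (c.state a) r).2)
  received := c.received

/-- The effect of an event on a configuration. A delivery on a link on which no message is waiting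
has no effect. -/
def next (c : Config A) : Event V A.Msg → Config A
  | .idle => c
  | .tick a => A.exec c a none
  | .deliver a b =>
      match (c.sent a)[c.received a b]? with
      | none => c
      | some m =>
          A.exec { c with
            received := Function.update c.received a
              (Function.update (c.received a) b (c.received a b + 1)) } b (some (a, m))
  | .byzantine a ms => { c with sent := Function.update c.sent a (c.sent a ++ ms) }

/-- The configuration after the first `t` events of the sequence `e`. -/
def config (input : V → ℝ) (e : ℕ → Event V A.Msg) : ℕ → Config A
  | 0 => A.startConfig input
  | t + 1 => A.next (config input e t) (e t)

end Algorithm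

/-- The events that are possible on the network `G` when `F` is the set of faulty nodes: non-faulty
nodes follow the algorithm, messages travel along edges, and only faulty nodes broadcast
arbitrarily. Receptions by faulty nodes are not recorded: faulty nodes behave arbitrarily,
whatever they receive. -/
def Event.Possible {V : Type u} {M : Type v} (G : SimpleGraph V) (F : Finset V) :
    Event V M → Prop
  | .idle => True
  | .tick a => a ∉ F
  | .deliver a b => G.Adj a b ∧ b ∉ F
  | .byzantine a _ => a ∈ F

namespace Algorithm

variable {V : Type u} [DecidableEq V] (A : Algorithm.{u, v, w} V)

/-- The executions of `A` in the asynchronous system on `G` with set `F` of faulty nodes: all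
infinite sequences of possible events in which every non-faulty node keeps taking steps (at an
arbitrary, varying speed), and every message that has been broadcast is received after a finite
delay by every (non-faulty) neighbor of its sender. -/
structure IsExecution (G : SimpleGraph V) (F : Finset V) (input : V → ℝ)
    (e : ℕ → Event V A.Msg) : Prop where
  possible : ∀ t, (e t).Possible G F
  keeps_stepping : ∀ a, a ∉ F → ∀ t, ∃ t', t ≤ t' ∧ e t' = .tick a
  delivers : ∀ a b, G.Adj a b → b ∉ F → ∀ t k, k < ((A.config input e t).sent a).length →
    ∃ t', k < (A.config input e t').received a b

/-- In the execution `e`, node `a` decides on the output `y` at some (finite) time. -/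
def Decides (input : V → ℝ) (e : ℕ → Event V A.Msg) (a : V) (y : ℝ) : Prop :=
  ∃ t, A.output a ((A.config input e t).state a) = some y

/-- `A` solves `ε`-approximate Byzantine consensus on `G` in the asynchronous local broadcast model,
for inputs between `L` and `U`, tolerating at most `f` Byzantine faulty nodes. -/
def SolvesApproxConsensus (G : SimpleGraph V) (f : ℕ) (L U ε : ℝ) : Prop :=
  ∀ (F : Finset V) (input : V → ℝ) (e : ℕ → Event V A.Msg),
    F.card ≤ f → (∀ a, input a ∈ Set.Icc L U) → A.IsExecution G F input e →
      -- agreement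
      (∀ a b, a ∉ F → b ∉ F → ∀ y z, A.Decides input e a y → A.Decides input e b z →
        |y - z| ≤ ε) ∧
      -- validity
      (∀ a, a ∉ F → ∀ y, A.Decides input e a y → y ∈ convexHull ℝ (input '' {b | b ∉ F})) ∧
      -- termination
      (∀ a, a ∉ F → ∃ y, A.Decides input e a y)

end Algorithm

/-- `G` is `k`-(vertex-)connected: it has more than `k` vertices, and it stays connected when any
fewer than `k` vertices are removed. -/
def VertexConnected {V : Type u} [Fintype V] (G : SimpleGraph V) (k : ℕ) : Prop :=
  k < Fintype.card V ∧
    ∀ S : Finset V, S.card < k → (G.induce {a | a ∉ S}).Connected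

end AsyncBroadcast

/-
Suppose two nonempty disjoint sets of nodes `X` and `Y` are cut off from the rest of the graph by
sets `S` and `T` of at most `2f` nodes, with at most `f` nodes in each of `S \ T` and `T \ S`.
Choose `C ⊆ S ∩ T` such that `C`, `S \ C` and `T \ C` have at most `f` nodes each, and run the
algorithm with `C` faulty and silent, with input `L` on `X` and input `U` elsewhere. Until a node of
`X` decides, `X` sees the same in an execution in which the input is `L` everywhere, the nodes of
`S \ C` are faulty and broadcast what they broadcast in the original run, and all nodes outside
`X ∪ (S \ C)`, those of `C` included, are merely slow. By validity there, `X` decides on `L`;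
likewise `Y` decides on `U`, against agreement.

If removing `S` disconnects the graph, take two of the remaining components and `T = S`. If
`n ≤ 2f + 1`, take `X = {x}` and `Y = {y}`, cut off by their complements.
-/

namespace AsyncBroadcast

open Filter

section Sequences

theorem exists_seq_frequently_eq {α : Type*} {s : Set α} (hs : s.Countable) (hne : s.Nonempty) :
    ∃ u : ℕ → α, (∀ n, u n ∈ s) ∧ ∀ x ∈ s, ∃ᶠ n in atTop, u n = x := by
  obtain ⟨g, rfl⟩ := hs.exists_eq_range hne
  refine ⟨fun n => g n.unpair.1, fun n => ⟨_, rfl⟩, ?_⟩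
  rintro _ ⟨k, rfl⟩
  exact frequently_atTop.mpr fun n => ⟨k.pair n, Nat.right_le_pair k n, by simp⟩

theorem prefix_update_append {ι α : Type*} [DecidableEq ι] (s : ι → List α) (i j : ι)
    (l : List α) : s j <+: Function.update s i (s i ++ l) j := by
  obtain rfl | hji := eq_or_ne j i
  · simp
  · simp [hji]

end Sequences

section Events

variable {V : Type u} {M : Type v} {G : SimpleGraph V} {F : Finset V}

/-- The node that acts at an event, if any; at a delivery this is the receiver. -/
def Event.actor : Event V M → Option V
  | .idle => none
  | .tick a => some a
  | .deliver _ b => some b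
  | .byzantine a _ => some a

theorem Event.notMem_actor_of_ne {ev : Event V M} {a b : V} (ha : ev.actor = some a)
    (hba : b ≠ a) : b ∉ ev.actor := by
  simpa [ha] using hba.symm

/-- No node of `F` acts. With `F` the set of faulty nodes this models a crash of `F` before the
start. -/
def Event.SilentOn (F : Finset V) (ev : Event V M) : Prop :=
  ∀ a ∈ ev.actor, a ∉ F

theorem Event.Possible.of_silentOn {C : Finset V} {ev : Event V M} (hp : ev.Possible G C)
    (hC : ev.SilentOn C) (hF : ev.SilentOn F) : ev.Possible G F := by
  cases ev with
  | idle => trivial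
  | tick a => exact hF a rfl
  | deliver a b => exact ⟨hp.1, hF b rfl⟩
  | byzantine a ms => exact absurd hp (hC a rfl)

/-- A schedule that is fair whatever the algorithm does: every non-faulty node steps, and every link
to a non-faulty node is served, infinitely often. -/
structure IsFairSchedule (G : SimpleGraph V) (F : Finset V) (e : ℕ → Event V M) : Prop where
  possible : ∀ t, (e t).Possible G F
  tick : ∀ a ∉ F, ∃ᶠ t in atTop, e t = .tick a
  deliver : ∀ a b, G.Adj a b → b ∉ F → ∃ᶠ t in atTop, e t = .deliver a b

theorem exists_isFairSchedule_silentOn [Countable V] (M : Type v) (G : SimpleGraph V)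
    (F : Finset V) :
    ∃ e : ℕ → Event V M, IsFairSchedule G F e ∧ ∀ t, (e t).SilentOn F := by
  let s : Set (Event V M) := {ev | ev.Possible G F ∧ ev.SilentOn F}
  have hs : s.Countable := by
    refine (((Set.countable_range Event.tick).union
      (Set.countable_range fun p : V × V => Event.deliver p.1 p.2)).insert Event.idle).mono ?_
    rintro (_ | a | ⟨a, b⟩ | ⟨a, ms⟩) ⟨hp, hF⟩
    · exact .inl rfl
    · exact .inr (.inl ⟨a, rfl⟩)
    · exact .inr (.inr ⟨(a, b), rfl⟩)
    · exact absurd hp (hF a rfl)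
  obtain ⟨e, hes, hfreq⟩ :=
    exists_seq_frequently_eq hs ⟨.idle, trivial, by simp [Event.SilentOn, Event.actor]⟩
  refine ⟨e, ⟨fun t => (hes t).1, fun a ha => hfreq _ ⟨ha, ?_⟩,
    fun a b hab hb => hfreq _ ⟨⟨hab, hb⟩, ?_⟩⟩, fun t => (hes t).2⟩
  · simpa [Event.SilentOn, Event.actor] using ha
  · simpa [Event.SilentOn, Event.actor] using hb

theorem exists_isFairSchedule_extending [Countable V] {T : ℕ} {e : ℕ → Event V M}
    (he : ∀ t < T, (e t).Possible G F) :
    ∃ e' : ℕ → Event V M, IsFairSchedule G F e' ∧ ∀ t < T, e' t = e t := by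
  obtain ⟨g, hg, -⟩ := exists_isFairSchedule_silentOn M G F
  let e' : ℕ → Event V M := fun t => if t < T then e t else g t
  have hearly : ∀ t < T, e' t = e t := fun t ht => if_pos ht
  have hlate : ∀ t ≥ T, e' t = g t := fun t ht => if_neg ht.not_gt
  have hfreq : ∀ {ev}, (∃ᶠ t in atTop, g t = ev) → ∃ᶠ t in atTop, e' t = ev := fun h =>
    h.mp ((eventually_ge_atTop T).mono fun t ht hgt => (hlate t ht).trans hgt)
  refine ⟨e', ⟨fun t => ?_, fun a ha => hfreq (hg.tick a ha),
    fun a b hab hb => hfreq (hg.deliver a b hab hb)⟩, hearly⟩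
  obtain ht | ht := lt_or_ge t T
  · exact hearly t ht ▸ he t ht
  · exact hlate t ht ▸ hg.possible t

end Events

section Executions

variable {V : Type u} [DecidableEq V] {A : Algorithm.{u, v, w} V} {a b : V} {c : Config A}
  {ev : Event V A.Msg}

namespace Algorithm

theorem next_state_of_notMem_actor (h : a ∉ ev.actor) : (A.next c ev).state a = c.state a := by
  cases ev with
  | idle | byzantine => rfl
  | tick => exact Function.update_of_ne (fun hab => h (congrArg some hab.symm)) _ _
  | deliver =>
    simp only [next]
    split
    · rfl
    · exact Function.update_of_ne (fun hab => h (congrArg some hab.symm)) _ _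

theorem next_sent_of_notMem_actor (h : a ∉ ev.actor) : (A.next c ev).sent a = c.sent a := by
  cases ev with
  | idle => rfl
  | tick | byzantine => exact Function.update_of_ne (fun hab => h (congrArg some hab.symm)) _ _
  | deliver =>
    simp only [next]
    split
    · rfl
    · exact Function.update_of_ne (fun hab => h (congrArg some hab.symm)) _ _

theorem next_received_of_notMem_actor (h : b ∉ ev.actor) :
    (A.next c ev).received a b = c.received a b := by
  cases ev with
  | idle | tick | byzantine => rfl
  | deliver p q =>
    have hbq : b ≠ q := fun hbq => h (congrArg some hbq.symm)
    simp only [next]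
    split
    · rfl
    · obtain rfl | hap := eq_or_ne a p
      · simp [exec, hbq]
      · simp [exec, hap]

variable (A) in
theorem sent_prefix_next (c : Config A) (ev : Event V A.Msg) (a : V) :
    c.sent a <+: (A.next c ev).sent a := by
  cases ev with
  | idle => exact List.prefix_rfl
  | tick | byzantine => exact prefix_update_append _ _ _ _
  | deliver =>
    simp only [next]
    split
    · exact List.prefix_rfl
    · exact prefix_update_append _ _ _ _

variable (A) in
theorem received_le_next (c : Config A) (ev : Event V A.Msg) :
    c.received ≤ (A.next c ev).received := by
  cases ev with
  | idle | tick | byzantine => exact le_rfl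
  | deliver =>
    simp only [next]
    split
    · exact le_rfl
    · simp [exec]

theorem lt_received_next_deliver {k : ℕ} (hr : k ≤ c.received a b)
    (hs : k < (c.sent a).length) : k < (A.next c (.deliver a b)).received a b := by
  obtain hlt | rfl := hr.lt_or_eq
  · exact hlt.trans_le (A.received_le_next c _ a b)
  · simp [next, exec, hs]

variable (A) in
theorem monotone_length_sent (input : V → ℝ) (e : ℕ → Event V A.Msg) (a : V) :
    Monotone fun t => ((A.config input e t).sent a).length :=
  monotone_nat_of_le_succ fun t => (A.sent_prefix_next _ (e t) a).length_le

variable (A) in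
theorem monotone_received (input : V → ℝ) (e : ℕ → Event V A.Msg) :
    Monotone fun t => (A.config input e t).received :=
  monotone_nat_of_le_succ fun t => A.received_le_next _ (e t)

theorem exists_le_received {input : V → ℝ} {e : ℕ → Event V A.Msg}
    (hab : ∃ᶠ t in atTop, e t = .deliver a b) {t k : ℕ}
    (hk : k ≤ ((A.config input e t).sent a).length) :
    ∃ s, k ≤ (A.config input e s).received a b := by
  induction k with
  | zero => exact ⟨0, Nat.zero_le _⟩
  | succ k ih =>
    obtain ⟨s, hs⟩ := ih (Nat.le_of_succ_le hk)
    obtain ⟨r, hr, her⟩ := frequently_atTop.mp hab (max t s)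
    have hreceived : k ≤ (A.config input e r).received a b :=
      hs.trans (A.monotone_received input e ((le_max_right t s).trans hr) a b)
    have hsent : k < ((A.config input e r).sent a).length :=
      hk.trans (A.monotone_length_sent input e a ((le_max_left t s).trans hr))
    refine ⟨r + 1, ?_⟩
    rw [config, her]
    exact lt_received_next_deliver hreceived hsent

end Algorithm

theorem IsFairSchedule.isExecution {G : SimpleGraph V} {F : Finset V} {e : ℕ → Event V A.Msg}
    (h : IsFairSchedule G F e) (input : V → ℝ) : A.IsExecution G F input e where
  possible := h.possible
  keeps_stepping a ha := frequently_atTop.mp (h.tick a ha)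
  delivers a b hab hb _ _ hk := Algorithm.exists_le_received (h.deliver a b hab hb) hk

end Executions

section Indistinguishability

variable {V : Type u} [DecidableEq V] {A : Algorithm.{u, v, w} V} {X W : Set V} {a : V}
  {c d : Config A} {ev : Event V A.Msg}

/-- The configurations `c` and `d` cannot be told apart by the nodes in `X` as long as these hear
from nodes in `W` only. -/
structure Config.Agree (X W : Set V) (c d : Config A) : Prop where
  state : ∀ a ∈ X, c.state a = d.state a
  sent : ∀ a ∈ W, c.sent a = d.sent a
  received : ∀ a, ∀ b ∈ X, c.received a b = d.received a b

namespace Config.Agree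

theorem exec (h : c.Agree X W d) (ha : a ∈ X) (r : Option (V × A.Msg)) :
    (A.exec c a r).Agree X W (A.exec d a r) where
  state b hb := by
    obtain rfl | hba := eq_or_ne b a
    · simp [Algorithm.exec, h.state b hb]
    · simp [Algorithm.exec, hba, h.state b hb]
  sent b hb := by
    obtain rfl | hba := eq_or_ne b a
    · simp [Algorithm.exec, h.state b ha, h.sent b hb]
    · simp [Algorithm.exec, hba, h.sent b hb]
  received := h.received

theorem next (h : c.Agree X W d) (hX : ∀ a ∈ ev.actor, a ∈ X)
    (hW : ∀ a b, ev = .deliver a b → a ∈ W) : (A.next c ev).Agree X W (A.next d ev) := by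
  cases ev with
  | idle => exact h
  | tick a => exact h.exec (hX a rfl) none
  | deliver a b =>
    have hb : b ∈ X := hX b rfl
    simp only [Algorithm.next, h.sent a (hW a b rfl), h.received a b hb]
    split
    · exact h
    · refine exec ?_ hb _
      refine ⟨h.state, h.sent, fun p q hq => ?_⟩
      obtain rfl | hpa := eq_or_ne p a
      · obtain rfl | hqb := eq_or_ne q b
        · simp
        · simp [hqb, h.received p q hq]
      · simp [hpa, h.received p q hq]
  | byzantine a ms =>
    refine ⟨h.state, fun b hb => ?_, h.received⟩
    obtain rfl | hba := eq_or_ne b a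
    · simp [Algorithm.next, h.sent b hb]
    · simp [Algorithm.next, hba, h.sent b hb]

theorem next_left (h : c.Agree X W d) (hX : a ∉ X) (hW : a ∉ W) (ha : ev.actor = some a) :
    (A.next c ev).Agree X W d := by
  have hneX : ∀ b ∈ X, b ∉ ev.actor := fun b hb =>
    Event.notMem_actor_of_ne ha (ne_of_mem_of_not_mem hb hX)
  have hneW : ∀ b ∈ W, b ∉ ev.actor := fun b hb =>
    Event.notMem_actor_of_ne ha (ne_of_mem_of_not_mem hb hW)
  refine ⟨fun b hb => ?_, fun b hb => ?_, fun p b hb => ?_⟩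
  · rw [Algorithm.next_state_of_notMem_actor (hneX b hb), h.state b hb]
  · rw [Algorithm.next_sent_of_notMem_actor (hneW b hb), h.sent b hb]
  · rw [Algorithm.next_received_of_notMem_actor (hneX b hb), h.received p b hb]

end Config.Agree

/-- The messages that `a` broadcasts at the event `ev` in the configuration `c`. -/
def Algorithm.broadcasts (A : Algorithm.{u, v, w} V) (c : Config A) (ev : Event V A.Msg) (a : V) :
    List A.Msg :=
  ((A.next c ev).sent a).drop (c.sent a).length

theorem Algorithm.sent_append_broadcasts (A : Algorithm.{u, v, w} V) (c : Config A)
    (ev : Event V A.Msg) (a : V) : c.sent a ++ A.broadcasts c ev a = (A.next c ev).sent a :=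
  List.prefix_iff_eq_append.mp (A.sent_prefix_next c ev a)

theorem Config.Agree.next_byzantine (h : c.Agree X W d) (hX : a ∉ X) (ha : ev.actor = some a) :
    (A.next c ev).Agree X W (A.next d (.byzantine a (A.broadcasts c ev a))) := by
  have hneX : ∀ b ∈ X, b ∉ ev.actor := fun b hb =>
    Event.notMem_actor_of_ne ha (ne_of_mem_of_not_mem hb hX)
  refine ⟨fun b hb => ?_, fun b hb => ?_, fun p b hb => ?_⟩
  · rw [Algorithm.next_state_of_notMem_actor (hneX b hb), h.state b hb]; rfl
  · obtain rfl | hba := eq_or_ne b a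
    · simp [Algorithm.next, ← h.sent b hb, Algorithm.sent_append_broadcasts]
    · rw [Algorithm.next_sent_of_notMem_actor (Event.notMem_actor_of_ne ha hba), h.sent b hb]
      exact (Function.update_of_ne hba _ _).symm
  · rw [Algorithm.next_received_of_notMem_actor (hneX b hb), h.received p b hb]; rfl

open Classical in
/-- The event by which `ev`, occurring in the configuration `c`, is imitated for the nodes in `X`:
the nodes in `X` act as in `ev`, the nodes in `D` are faulty and broadcast the same messages as in
`ev`, and all other nodes wait. -/
noncomputable def Event.imitate (X : Set V) (D : Finset V) (c : Config A) (ev : Event V A.Msg) :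
    Event V A.Msg :=
  match ev.actor with
  | none => ev
  | some a => if a ∈ X then ev else if a ∈ D then .byzantine a (A.broadcasts c ev a) else .idle

/-- `S` separates `X` from the other nodes: it is disjoint from `X`, and every edge that leaves `X`
ends in `S`. -/
structure Encloses (G : SimpleGraph V) (S : Finset V) (X : Set V) : Prop where
  notMem : ∀ a ∈ X, a ∉ S
  mem_or_mem : ∀ a b, G.Adj a b → b ∈ X → a ∈ X ∨ a ∈ S

variable {G : SimpleGraph V} {S C : Finset V}

theorem Event.Possible.imitate (hX : Encloses G S X) (hp : ev.Possible G C)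
    (hC : ev.SilentOn C) : (ev.imitate X (S \ C) c).Possible G (S \ C) := by
  have hXD : ∀ a ∈ X, a ∉ S \ C := fun a ha haD => hX.notMem a ha (Finset.mem_sdiff.mp haD).1
  cases hactor : ev.actor with
  | none =>
    simp only [Event.imitate, hactor]
    exact hp.of_silentOn hC (by simp [Event.SilentOn, hactor])
  | some a =>
    simp only [Event.imitate, hactor]
    split_ifs with haX haD
    · exact hp.of_silentOn hC (by simpa [Event.SilentOn, hactor] using hXD a haX)
    · exact haD
    · trivial

theorem Config.Agree.next_imitate (hX : Encloses G S X) (h : c.Agree X (X ∪ S) d)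
    (hp : ev.Possible G C) (hC : ev.SilentOn C) :
    (A.next c ev).Agree X (X ∪ S) (A.next d (ev.imitate X (S \ C) c)) := by
  have hsame (hactor : ∀ a ∈ ev.actor, a ∈ X) :
      (A.next c ev).Agree X (X ∪ S) (A.next d ev) := by
    refine h.next hactor ?_
    rintro a b rfl
    exact hX.mem_or_mem a b hp.1 (hactor b rfl)
  cases hactor : ev.actor with
  | none =>
    simp only [Event.imitate, hactor]
    exact hsame (by simp [hactor])
  | some a =>
    simp only [Event.imitate, hactor]
    split_ifs with haX haD
    · exact hsame (by simpa [hactor] using haX)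
    · exact h.next_byzantine haX hactor
    · have haS : a ∉ S := fun haS => haD (Finset.mem_sdiff.mpr ⟨haS, hC a hactor⟩)
      exact h.next_left haX (by simp [haX, haS]) hactor

theorem Algorithm.agree_config_imitate (hX : Encloses G S X) {input input' : V → ℝ}
    (hinput : ∀ a ∈ X, input a = input' a) {e e' : ℕ → Event V A.Msg}
    (hp : ∀ t, (e t).Possible G C) (hC : ∀ t, (e t).SilentOn C) {T : ℕ}
    (he' : ∀ t < T, e' t = (e t).imitate X (S \ C) (A.config input e t)) :
    (A.config input e T).Agree X (X ∪ S) (A.config input' e' T) := by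
  induction T with
  | zero => exact ⟨fun a ha => congrArg (A.start a) (hinput a ha), fun _ _ => rfl, fun _ _ _ => rfl⟩
  | succ T ih =>
    simp only [Algorithm.config, he' T T.lt_succ_self]
    exact (ih fun t ht => he' t (ht.trans T.lt_succ_self)).next_imitate hX (hp T) (hC T)

theorem Algorithm.Decides.exists_indistinguishable [Countable V] (hX : Encloses G S X)
    {input input' : V → ℝ} (hinput : ∀ a ∈ X, input a = input' a) {e : ℕ → Event V A.Msg}
    (hp : ∀ t, (e t).Possible G C) (hC : ∀ t, (e t).SilentOn C) {x : V} (hx : x ∈ X) {y : ℝ}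
    (hy : A.Decides input e x y) :
    ∃ e', A.IsExecution G (S \ C) input' e' ∧ A.Decides input' e' x y := by
  obtain ⟨T, hT⟩ := hy
  obtain ⟨e', hfair, he'⟩ := exists_isFairSchedule_extending (T := T)
    (e := fun t => (e t).imitate X (S \ C) (A.config input e t))
    fun t _ => (hp t).imitate hX (hC t)
  have hagree := agree_config_imitate hX hinput hp hC he'
  exact ⟨e', hfair.isExecution input', T, hagree.state x hx ▸ hT⟩

end Indistinguishability

section Enclosures

variable {V : Type u} {G : SimpleGraph V}

theorem encloses_compl_singleton [Fintype V] [DecidableEq V] (G : SimpleGraph V) (x : V) :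
    Encloses G {x}ᶜ {x} where
  notMem a ha := by simpa using ha
  mem_or_mem a _ _ _ := by simpa using em (a = x)

theorem encloses_componentCompl {S : Finset V} (K : G.ComponentCompl (S : Set V)) :
    Encloses G S (K : Set V) where
  notMem _ ha := SimpleGraph.ComponentCompl.notMem_of_mem ha
  mem_or_mem a b hab hb :=
    or_iff_not_imp_right.mpr fun ha => SimpleGraph.ComponentCompl.mem_of_adj b a hb ha hab.symm

theorem exists_subset_inter_card_le [DecidableEq V] {S T : Finset V} {f : ℕ} (hS : S.card ≤ 2 * f)
    (hT : T.card ≤ 2 * f) (hST : (S \ T).card ≤ f) (hTS : (T \ S).card ≤ f) :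
    ∃ C, C ⊆ S ∧ C ⊆ T ∧ C.card ≤ f ∧ (S \ C).card ≤ f ∧ (T \ C).card ≤ f := by
  obtain ⟨C, hC, hcard⟩ := Finset.exists_subset_card_eq (min_le_right f (S ∩ T).card)
  have hCS : C ⊆ S := hC.trans Finset.inter_subset_left
  have hCT : C ⊆ T := hC.trans Finset.inter_subset_right
  have hS' := Finset.card_sdiff_add_card_inter S T
  have hT' := Finset.card_sdiff_add_card_inter T S
  rw [Finset.inter_comm] at hT'
  refine ⟨C, hCS, hCT, by omega, ?_, ?_⟩
  · rw [Finset.card_sdiff_of_subset hCS]; omega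
  · rw [Finset.card_sdiff_of_subset hCT]; omega

end Enclosures

namespace Algorithm.SolvesApproxConsensus

variable {V : Type u} [DecidableEq V] {A : Algorithm.{u, v, w} V} {G : SimpleGraph V} {f : ℕ}
  {L U ε : ℝ} {X Y : Set V} {S T C : Finset V}

theorem decides_eq_of_const_input (hA : A.SolvesApproxConsensus G f L U ε) {F : Finset V}
    (hF : F.card ≤ f) {v : ℝ} (hv : v ∈ Set.Icc L U) {e : ℕ → Event V A.Msg}
    (he : A.IsExecution G F (fun _ => v) e) {x : V} (hx : x ∉ F) {y : ℝ}
    (hy : A.Decides (fun _ => v) e x y) : y = v := by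
  have hmem := (hA F _ e hF (fun _ => hv) he).2.1 x hx y hy
  have hsub : (fun _ : V => v) '' {b | b ∉ F} ⊆ {v} := by
    rintro _ ⟨_, _, rfl⟩
    rfl
  simpa using convexHull_mono hsub hmem

theorem decides_eq_of_encloses [Countable V] (hA : A.SolvesApproxConsensus G f L U ε)
    (hX : Encloses G S X) (hSC : (S \ C).card ≤ f) {input : V → ℝ} {v : ℝ}
    (hv : v ∈ Set.Icc L U) (hinput : ∀ a ∈ X, input a = v) {e : ℕ → Event V A.Msg}
    (hp : ∀ t, (e t).Possible G C) (hC : ∀ t, (e t).SilentOn C) {x : V} (hx : x ∈ X) {y : ℝ}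
    (hy : A.Decides input e x y) : y = v := by
  obtain ⟨e', he', hy'⟩ := hy.exists_indistinguishable hX (input' := fun _ => v) hinput hp hC hx
  have hxD : x ∉ S \ C := fun hxD => hX.notMem x hx (Finset.mem_sdiff.mp hxD).1
  exact hA.decides_eq_of_const_input hSC hv he' hxD hy'

open Classical in
theorem not_disjoint_of_encloses_of_sdiff [Countable V] (hA : A.SolvesApproxConsensus G f L U ε)
    (hLU : L ≤ U) (hε : ε < U - L) (hX : X.Nonempty) (hY : Y.Nonempty) (hSX : Encloses G S X)
    (hTY : Encloses G T Y) (hCS : C ⊆ S) (hCT : C ⊆ T) (hC : C.card ≤ f)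
    (hSC : (S \ C).card ≤ f) (hTC : (T \ C).card ≤ f) : ¬ Disjoint X Y := by
  intro hXY
  obtain ⟨x, hx⟩ := hX
  obtain ⟨y, hy⟩ := hY
  obtain ⟨e, hfair, hsilent⟩ := exists_isFairSchedule_silentOn A.Msg G C
  let input : V → ℝ := fun a => if a ∈ X then L else U
  have hL : L ∈ Set.Icc L U := Set.left_mem_Icc.mpr hLU
  have hU : U ∈ Set.Icc L U := Set.right_mem_Icc.mpr hLU
  have hinput : ∀ a, input a ∈ Set.Icc L U := fun a => ite_mem.mpr ⟨fun _ => hL, fun _ => hU⟩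
  have hxC : x ∉ C := fun h => hSX.notMem x hx (hCS h)
  have hyC : y ∉ C := fun h => hTY.notMem y hy (hCT h)
  obtain ⟨agreement, -, termination⟩ := hA C input e hC hinput (hfair.isExecution input)
  obtain ⟨p, hp⟩ := termination x hxC
  obtain ⟨q, hq⟩ := termination y hyC
  obtain rfl : p = L := hA.decides_eq_of_encloses hSX hSC hL (fun a ha => if_pos ha)
    hfair.possible hsilent hx hp
  obtain rfl : q = U := hA.decides_eq_of_encloses hTY hTC hU
    (fun a ha => if_neg (hXY.notMem_of_mem_right ha)) hfair.possible hsilent hy hq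
  have hclose : |q - p| ≤ ε := agreement y x hyC hxC q p hq hp
  exact (hε.trans_le (le_abs_self _)).not_ge hclose

theorem not_disjoint_of_encloses [Countable V] (hA : A.SolvesApproxConsensus G f L U ε)
    (hLU : L ≤ U) (hε : ε < U - L) (hX : X.Nonempty) (hY : Y.Nonempty) (hSX : Encloses G S X)
    (hTY : Encloses G T Y) (hS : S.card ≤ 2 * f) (hT : T.card ≤ 2 * f) (hST : (S \ T).card ≤ f)
    (hTS : (T \ S).card ≤ f) : ¬ Disjoint X Y := by
  obtain ⟨C, hCS, hCT, hC, hSC, hTC⟩ := exists_subset_inter_card_le hS hT hST hTS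
  exact hA.not_disjoint_of_encloses_of_sdiff hLU hε hX hY hSX hTY hCS hCT hC hSC hTC

theorem two_mul_add_one_lt_card [Fintype V] (hA : A.SolvesApproxConsensus G f L U ε)
    (hLU : L ≤ U) (hε : ε < U - L) (hf : 0 < f) (hfn : f < Fintype.card V) :
    2 * f + 1 < Fintype.card V := by
  by_contra! hn
  obtain ⟨x, y, hxy⟩ := Fintype.exists_pair_of_one_lt_card (by omega : 1 < Fintype.card V)
  have hcard (z : V) : ({z}ᶜ : Finset V).card ≤ 2 * f := by
    rw [Finset.card_compl, Finset.card_singleton]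
    omega
  have hsdiff (z z' : V) : (({z}ᶜ : Finset V) \ {z'}ᶜ).card ≤ f := by
    rw [sdiff_compl]
    exact (Finset.card_le_card Finset.inter_subset_right).trans hf
  exact hA.not_disjoint_of_encloses hLU hε (Set.singleton_nonempty x) (Set.singleton_nonempty y)
    (encloses_compl_singleton G x) (encloses_compl_singleton G y) (hcard x) (hcard y)
    (hsdiff x y) (hsdiff y x) (Set.disjoint_singleton.mpr hxy)

theorem preconnected_induce_compl [Countable V] (hA : A.SolvesApproxConsensus G f L U ε)
    (hLU : L ≤ U) (hε : ε < U - L) (hS : S.card ≤ 2 * f) :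
    (G.induce (S : Set V)ᶜ).Preconnected := by
  intro x y
  by_contra hxy
  have hne : G.componentComplMk x.2 ≠ G.componentComplMk y.2 :=
    mt SimpleGraph.ConnectedComponent.exact hxy
  exact hA.not_disjoint_of_encloses hLU hε (SimpleGraph.ComponentCompl.nonempty _)
    (SimpleGraph.ComponentCompl.nonempty _) (encloses_componentCompl _) (encloses_componentCompl _)
    hS hS (by simp) (by simp) (SimpleGraph.ComponentCompl.pairwise_disjoint hne)

end Algorithm.SolvesApproxConsensus

end AsyncBroadcast

theorem theorem2 {V : Type u} [Fintype V] [DecidableEq V] (G : SimpleGraph V)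
    (f : ℕ) (hf : 0 < f) (hfn : f < Fintype.card V)
    (L U ε : ℝ) (hε : 0 < ε) (hLU : ε < U - L)
    (h : ∃ A : AsyncBroadcast.Algorithm.{u, v, w} V, A.SolvesApproxConsensus G f L U ε) :
    AsyncBroadcast.VertexConnected G (2 * f + 1) := by
  obtain ⟨A, hA⟩ := h
  have hLU' : L ≤ U := sub_nonneg.mp (hε.trans hLU).le
  have hcard : 2 * f + 1 < Fintype.card V := hA.two_mul_add_one_lt_card hLU' hLU hf hfn
  refine ⟨hcard, fun S hS => ?_⟩
  obtain ⟨a, ha⟩ : ∃ a, a ∉ S := by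
    by_contra! hall
    rw [Finset.eq_univ_iff_forall.mpr hall, Finset.card_univ] at hS
    omega
  have : Nonempty {a | a ∉ S} := ⟨⟨a, ha⟩⟩
  exact ⟨hA.preconnected_induce_compl hLU' hLU (Nat.le_of_lt_succ hS)⟩
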